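/- Let $n\ge 2$ be an integer, and write $\|\cdot\|$ for the Euclidean norm on $\mathbb{R}^n$. Let $\tau>n-1$ and $\gamma\in(0,1)$ be real numbers such that there exists a unit vector $\beta\in\mathbb{R}^n$ with $|k\cdot\beta|\ge\gamma\|k\|^{-\tau}$ for every $k\in\mathbb{Z}^n\setminus\{0\}$. Let $N>1+n^2\,n!$ be a real number, and let $\alpha\in\mathbb{R}^n$ be a unit vector such that $|k\cdot\alpha|\ge\gamma\|k\|^{-\tau}$ for every $k\in\mathbb{Z}^n$ with $0<\|k\|\le N$. Then there exist vectors $\omega_1,\dots,\omega_n\in\mathbb{R}^n$ and real numbers $x_1,\dots,x_n$ such that, for each $j\in\{1,\dots,n\}$, (i) $\displaystyle \frac{\sqrt3}{2}<x_j\le\frac{n\,n!\,N^\tau}{\gamma}$, (ii) $\displaystyle \|\alpha-\omega_j\|\le\frac{n\,n!}{x_j(N-1)}$, and moreover (iii) $\{x_1\omega_1,\dots,x_n\omega_n\}$ is a $\mathbb{Z}$-basis of $\mathbb{Z}^n$. -/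

import Mathlib

noncomputable section

namespace TruncDioph

/-- The integer vector `k`, regarded as a point of Euclidean space `ℝⁿ`. -/
def intVec {n : ℕ} (k : Fin n → ℤ) : EuclideanSpace ℝ (Fin n) :=
  WithLp.toLp 2 (fun i => (k i : ℝ))

/-- The Diophantine vectors: `|k · α| ≥ γ ‖k‖^(-τ)` for all nonzero integer vectors `k`. -/
def diophantine (n : ℕ) (τ γ : ℝ) : Set (EuclideanSpace ℝ (Fin n)) :=
  {α | ∀ k : Fin n → ℤ, k ≠ 0 → γ * ‖intVec k‖ ^ (-τ) ≤ |inner ℝ (intVec k) α|}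

/-- The truncated Diophantine vectors: `|k · α| ≥ γ ‖k‖^(-τ)` for all integer vectors `k` with
`0 < ‖k‖ ≤ N`. -/
def truncDiophantine (n : ℕ) (τ γ N : ℝ) : Set (EuclideanSpace ℝ (Fin n)) :=
  {α | ∀ k : Fin n → ℤ, 0 < ‖intVec k‖ → ‖intVec k‖ ≤ N →
    γ * ‖intVec k‖ ^ (-τ) ≤ |inner ℝ (intVec k) α|}

/-- The Diophantine vectors of unit Euclidean length. -/
def unitDiophantine (n : ℕ) (τ γ : ℝ) : Set (EuclideanSpace ℝ (Fin n)) :=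
  Metric.sphere 0 1 ∩ diophantine n τ γ

/-- The truncated Diophantine vectors of unit Euclidean length. -/
def unitTruncDiophantine (n : ℕ) (τ γ N : ℝ) : Set (EuclideanSpace ℝ (Fin n)) :=
  Metric.sphere 0 1 ∩ truncDiophantine n τ γ N

/-- The family `v` of points of `ℝⁿ` is a `ℤ`-basis of `ℤⁿ ⊆ ℝⁿ`. -/
def IsIntBasis {n : ℕ} (v : Fin n → EuclideanSpace ℝ (Fin n)) : Prop :=
  ∃ b : Module.Basis (Fin n) ℤ (Fin n → ℤ), ∀ j, intVec (b j) = v j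

end TruncDioph

end

/-! Let T scale by A = γN^(-τ) along α and by N-1 orthogonally to α. T is symmetric, so w is dual to
Tℤⁿ exactly when Tw is integral. A nonzero such w with ‖w‖ < 1 would give an integer vector k = Tw
with ‖k‖ ≤ N and |k·α| < A, against the Diophantine condition. So nonzero dual vectors have norm at
least 1, and `exists_short_generators` turns this into n generators Tv_j of norm at most n!. With
x_j = α·v_j and ω_j = v_j/x_j, the component of Tv_j along α bounds x_j, and the orthogonal one
bounds ‖α-ω_j‖.

The generators come from induction on rank: a shortest dual vector w slices the lattice into
parallel layers ⟨w,·⟩ ∈ ℤ, and the layer through 0 is a lattice whose squared dual minimum drops by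
a factor of at most 3/4. -/

open Module Submodule

/-! ### Lattice reduction from a lower bound on dual vectors. -/

section DualReduction

variable {E : Type*} [NormedAddCommGroup E] [InnerProductSpace ℝ E]

/-- `w` pairs integrally with every vector of `L`. -/
def IsDualVector (L : Submodule ℤ E) (w : E) : Prop :=
  ∀ x ∈ L, ∃ z : ℤ, inner ℝ w x = (z : ℝ)

lemma isClosed_isDualVector (L : Submodule ℤ E) : IsClosed {w : E | IsDualVector L w} := by
  have h : {w : E | IsDualVector L w} =
      ⋂ x ∈ L, (fun w : E => inner ℝ w x) ⁻¹' Set.range ((↑) : ℤ → ℝ) := by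
    ext w
    simp [IsDualVector, eq_comm]
  rw [h]
  refine isClosed_biInter fun x _ => ?_
  exact (Int.isClosedEmbedding_coe_real.isClosed_range).preimage (by fun_prop)

/-- A coordinate functional of a lattice basis, represented by the inner product, is integral on
`L`. -/
lemma exists_ne_zero_isDualVector [FiniteDimensional ℝ E] [Nontrivial E] (L : Submodule ℤ E)
    [DiscreteTopology L] [IsZLattice ℝ L] : ∃ w : E, w ≠ 0 ∧ IsDualVector L w := by
  have : Module.Free ℤ L := ZLattice.module_free ℝ L
  have : Module.Finite ℤ L := ZLattice.module_finite ℝ L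
  let b := Module.Free.chooseBasis ℤ L
  let b' := b.ofZLatticeBasis ℝ L
  obtain ⟨i⟩ := b'.index_nonempty
  refine ⟨(InnerProductSpace.toDual ℝ E).symm (b'.coord i).toContinuousLinearMap, ?_, ?_⟩
  · intro h
    have h1 := InnerProductSpace.toDual_symm_apply (𝕜 := ℝ) (x := b' i)
      (y := (b'.coord i).toContinuousLinearMap)
    rw [h] at h1
    simp at h1
  · intro x hx
    refine ⟨b.repr ⟨x, hx⟩ i, ?_⟩
    rw [InnerProductSpace.toDual_symm_apply]
    exact b.ofZLatticeBasis_repr_apply ℝ L ⟨x, hx⟩ i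

lemma exists_shortest_isDualVector [FiniteDimensional ℝ E] [Nontrivial E] (L : Submodule ℤ E)
    [DiscreteTopology L] [IsZLattice ℝ L] {r : ℝ} (hr : 0 < r)
    (hL : ∀ w : E, w ≠ 0 → IsDualVector L w → r ≤ ‖w‖ ^ 2) :
    ∃ w : E, w ≠ 0 ∧ IsDualVector L w ∧ ∀ u : E, u ≠ 0 → IsDualVector L u → ‖w‖ ≤ ‖u‖ := by
  obtain ⟨w₀, hw₀, hd₀⟩ := exists_ne_zero_isDualVector L
  let S : Set E := {w | IsDualVector L w} ∩ {w | r ≤ ‖w‖ ^ 2}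
  have hS : IsClosed S :=
    (isClosed_isDualVector L).inter (isClosed_le continuous_const (by fun_prop))
  have hne : (S ∩ Metric.closedBall 0 ‖w₀‖).Nonempty := ⟨w₀, ⟨hd₀, hL w₀ hw₀ hd₀⟩, by simp⟩
  obtain ⟨w, ⟨⟨hwd, hwr⟩, hwb⟩, hmin⟩ :=
    ((isCompact_closedBall (0 : E) ‖w₀‖).inter_left hS).exists_isMinOn hne
      continuous_norm.continuousOn
  refine ⟨w, ?_, hwd, fun u hu hud => ?_⟩
  · rintro rfl
    have : r ≤ ‖(0 : E)‖ ^ 2 := hwr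
    simp at this
    linarith
  · rcases le_total ‖u‖ ‖w₀‖ with h | h
    · exact hmin ⟨⟨hud, hL u hu hud⟩, by simpa using h⟩
    · exact le_trans (by simpa using hwb) h

/-- The values of `w` on `L` form a group gℤ, nonzero because `L` spans. Then w/g is still dual, so
minimality forces |g| = 1. -/
lemma exists_inner_eq_one_of_shortest (L : Submodule ℤ E) [DiscreteTopology L] [IsZLattice ℝ L]
    {w : E} (hw : w ≠ 0) (hd : IsDualVector L w)
    (hmin : ∀ u : E, u ≠ 0 → IsDualVector L u → ‖w‖ ≤ ‖u‖) : ∃ v ∈ L, inner ℝ w v = (1 : ℝ) := by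
  let G : AddSubgroup ℤ :=
    { carrier := {m | ∃ x ∈ L, inner ℝ w x = (m : ℝ)}
      zero_mem' := ⟨0, L.zero_mem, by simp⟩
      add_mem' := by
        rintro a b ⟨x, hx, hxa⟩ ⟨y, hy, hyb⟩
        exact ⟨x + y, L.add_mem hx hy, by simp [inner_add_right, hxa, hyb]⟩
      neg_mem' := by
        rintro a ⟨x, hx, hxa⟩
        exact ⟨-x, L.neg_mem hx, by simp [inner_neg_right, hxa]⟩ }
  obtain ⟨g, hg⟩ := Int.subgroup_cyclic G
  have hgG : g ∈ G := by rw [hg]; exact AddSubgroup.subset_closure rfl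
  have hdvd : ∀ x ∈ L, ∃ z : ℤ, inner ℝ w x = (g : ℝ) * z := by
    intro x hx
    obtain ⟨m, hm⟩ := hd x hx
    have hmG : m ∈ G := ⟨x, hx, hm⟩
    rw [hg, AddSubgroup.mem_closure_singleton] at hmG
    obtain ⟨z, rfl⟩ := hmG
    exact ⟨z, by rw [hm]; push_cast [smul_eq_mul]; ring⟩
  have hg0 : g ≠ 0 := by
    rintro rfl
    have h0 : ∀ x ∈ span ℝ (L : Set E), inner ℝ w x = (0 : ℝ) := by
      intro x hx
      induction hx using Submodule.span_induction with
      | mem x hx => obtain ⟨z, hz⟩ := hdvd x hx; simpa using hz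
      | zero => simp
      | add x y _ _ hx hy => simp [inner_add_right, hx, hy]
      | smul a x _ hx => simp [inner_smul_right, hx]
    exact hw (inner_self_eq_zero.1 (h0 w (by rw [IsZLattice.span_top]; trivial)))
  have hgR : (g : ℝ) ≠ 0 := by exact_mod_cast hg0
  have h1 : ‖w‖ ≤ ‖(g : ℝ)⁻¹ • w‖ := by
    refine hmin _ (smul_ne_zero (inv_ne_zero hgR) hw) fun x hx => ?_
    obtain ⟨z, hz⟩ := hdvd x hx
    exact ⟨z, by rw [real_inner_smul_left, hz]; field_simp⟩
  have hle : |g| ≤ 1 := by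
    rw [norm_smul, norm_inv, Real.norm_eq_abs] at h1
    have hpos : 0 < |(g : ℝ)| := abs_pos.2 hgR
    have hwp : 0 < ‖w‖ := norm_pos_iff.2 hw
    rw [inv_mul_eq_div, le_div_iff₀ hpos] at h1
    have : |(g : ℝ)| ≤ 1 := by nlinarith
    exact_mod_cast this
  have hone : (1 : ℤ) ∈ G := by
    have hg1 : g = 1 ∨ g = -1 := by
      rw [abs_le] at hle
      omega
    rcases hg1 with rfl | rfl
    · exact hgG
    · simpa using G.neg_mem hgG
  obtain ⟨v, hv, hv1⟩ := hone
  exact ⟨v, hv, by simpa using hv1⟩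

/-- The section of `L` by the hyperplane orthogonal to `w`. -/
noncomputable def hyperplaneSection (L : Submodule ℤ E) (w : E) : Submodule ℤ (ℝ ∙ w)ᗮ :=
  L.comap ((ℝ ∙ w)ᗮ.subtype.restrictScalars ℤ)

instance (L : Submodule ℤ E) [DiscreteTopology L] (w : E) :
    DiscreteTopology (hyperplaneSection L w) :=
  DiscreteTopology.preimage_of_continuous_injective (L : Set E) continuous_subtype_val
    Subtype.val_injective

/-- The projection y ↦ y - ⟨w,y⟩v onto the hyperplane sends `L` into the section, so the section
inherits spanning. -/
lemma isZLattice_hyperplaneSection (L : Submodule ℤ E) [DiscreteTopology L] [IsZLattice ℝ L]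
    {v w : E} (hd : IsDualVector L w) (hv : v ∈ L) (hwv : inner ℝ w v = (1 : ℝ)) :
    IsZLattice ℝ (hyperplaneSection L w) := by
  have key : ∀ y ∈ span ℝ (L : Set E), y - (inner ℝ w y : ℝ) • v ∈
      (span ℝ (hyperplaneSection L w : Set (ℝ ∙ w)ᗮ)).map (ℝ ∙ w)ᗮ.subtype := by
    intro y hy
    induction hy using Submodule.span_induction with
    | mem x hx =>
      obtain ⟨z, hz⟩ := hd x hx
      have hx' : x - (inner ℝ w x : ℝ) • v ∈ (ℝ ∙ w)ᗮ := by
        rw [mem_orthogonal_singleton_iff_inner_right, inner_sub_right, inner_smul_right, hwv]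
        ring
      refine ⟨⟨_, hx'⟩, subset_span ?_, rfl⟩
      change x - (inner ℝ w x : ℝ) • v ∈ L
      rw [hz, Int.cast_smul_eq_zsmul]
      exact L.sub_mem hx (L.smul_mem z hv)
    | zero => simp
    | add x y _ _ hx hy =>
      convert add_mem hx hy using 1
      rw [inner_add_right]
      module
    | smul a x _ hx =>
      convert smul_mem _ a hx using 1
      rw [inner_smul_right]
      module
  refine ⟨eq_top_iff.2 fun y _ => ?_⟩
  have hy := key y (by rw [IsZLattice.span_top]; trivial)
  rw [mem_orthogonal_singleton_iff_inner_right.1 y.2, zero_smul, sub_zero] at hy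
  obtain ⟨y', hy', h⟩ := hy
  rwa [← Subtype.val_injective h]

lemma norm_sq_smul_add_of_mem_orthogonal {w u : E} (hu : u ∈ (ℝ ∙ w)ᗮ) (c : ℝ) :
    ‖c • w + u‖ ^ 2 = c ^ 2 * ‖w‖ ^ 2 + ‖u‖ ^ 2 := by
  rw [mem_orthogonal_singleton_iff_inner_right] at hu
  rw [norm_add_sq_real, real_inner_smul_left, hu, norm_smul, mul_pow, Real.norm_eq_abs, sq_abs]
  ring

/-- A dual vector of the section lifts to one of `L` by adding c • w with |c| ≤ 1/2. Minimality of
`w` gives ‖w‖² ≤ ‖w‖²/4 + ‖u‖². -/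
lemma three_quarters_le_of_isDualVector_hyperplaneSection {L : Submodule ℤ E} {v w : E} {r : ℝ}
    (hd : IsDualVector L w) (hv : v ∈ L) (hwv : inner ℝ w v = (1 : ℝ))
    (hmin : ∀ u : E, u ≠ 0 → IsDualVector L u → ‖w‖ ≤ ‖u‖) (hr : r ≤ ‖w‖ ^ 2)
    (u : (ℝ ∙ w)ᗮ) (hu : u ≠ 0) (hud : IsDualVector (hyperplaneSection L w) u) :
    3 / 4 * r ≤ ‖u‖ ^ 2 := by
  set t : ℝ := inner ℝ (u : E) v with ht
  -- Chosen so that c • w + u pairs with `v` to the integer `round t`.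
  set c : ℝ := round t - t with hc
  have hnorm := norm_sq_smul_add_of_mem_orthogonal u.2 c
  have hne : c • w + (u : E) ≠ 0 := by
    intro h
    rw [h, norm_zero] at hnorm
    have : 0 < ‖(u : E)‖ := norm_pos_iff.2 (by simpa using hu)
    nlinarith [mul_nonneg (sq_nonneg c) (sq_nonneg ‖w‖), pow_pos this 2]
  have hdual : IsDualVector L (c • w + (u : E)) := by
    intro x hx
    obtain ⟨z, hz⟩ := hd x hx
    have hx' : x - (z : ℝ) • v ∈ (ℝ ∙ w)ᗮ := by
      rw [mem_orthogonal_singleton_iff_inner_right, inner_sub_right, inner_smul_right, hwv, hz]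
      ring
    have hxL : x - (z : ℝ) • v ∈ L := by
      rw [Int.cast_smul_eq_zsmul]
      exact L.sub_mem hx (L.smul_mem z hv)
    obtain ⟨m, hm⟩ := hud ⟨_, hx'⟩ hxL
    have hm' : inner ℝ (u : E) (x - (z : ℝ) • v) = (m : ℝ) := hm
    rw [inner_sub_right, inner_smul_right, ← ht] at hm'
    refine ⟨m + z * round t, ?_⟩
    rw [inner_add_left, real_inner_smul_left, hz, hc]
    push_cast
    linarith
  have h1 := hmin _ hne hdual
  have h2 : ‖w‖ ^ 2 ≤ ‖c • w + (u : E)‖ ^ 2 := by gcongr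
  have h3 : c ^ 2 ≤ 1 / 4 := by
    have := abs_le.1 (abs_sub_round t)
    nlinarith
  have h4 : c ^ 2 * ‖w‖ ^ 2 ≤ 1 / 4 * ‖w‖ ^ 2 := by gcongr
  have h5 : ‖u‖ = ‖(u : E)‖ := rfl
  rw [h5]
  linarith

/-- A lattice of rank `n` whose nonzero dual vectors all have squared norm at least `r` is generated
by `n` vectors of squared norm at most `(4 / 3) ^ (n - 1) / r`. The bound on the covering radius is
what makes the induction work. -/
theorem exists_short_generators (n : ℕ) : ∀ {E : Type*} [NormedAddCommGroup E]
    [InnerProductSpace ℝ E] [FiniteDimensional ℝ E], finrank ℝ E = n →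
    ∀ (L : Submodule ℤ E) [DiscreteTopology L] [IsZLattice ℝ L] {r : ℝ}, 0 < r →
    (∀ w : E, w ≠ 0 → IsDualVector L w → r ≤ ‖w‖ ^ 2) →
    (∃ c : Fin n → E, (∀ i, c i ∈ L) ∧ L ≤ span ℤ (Set.range c) ∧
      ∀ i, r * ‖c i‖ ^ 2 ≤ 3 / 4 * (4 / 3) ^ n) ∧
    ∀ y : E, ∃ x ∈ L, r * ‖y - x‖ ^ 2 ≤ 3 / 4 * ((4 / 3) ^ n - 1) := by
  induction n with
  | zero =>
    intro E _ _ _ hE L _ _ r hr hL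
    have : Subsingleton E := finrank_zero_iff.1 hE
    refine ⟨⟨0, fun i => i.elim0, fun x _ => ?_, fun i => i.elim0⟩, fun y => ⟨0, L.zero_mem, ?_⟩⟩
    · rw [Subsingleton.elim x 0]
      exact zero_mem _
    · simp [Subsingleton.elim y 0]
  | succ n ih =>
    intro E _ _ _ hE L _ _ r hr hL
    have : Nontrivial E := nontrivial_of_finrank_eq_succ hE
    obtain ⟨w, hw, hd, hmin⟩ := exists_shortest_isDualVector L hr hL
    obtain ⟨v, hv, hwv⟩ := exists_inner_eq_one_of_shortest L hw hd hmin
    have hrw : r ≤ ‖w‖ ^ 2 := hL w hw hd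
    have hwp : 0 < ‖w‖ ^ 2 := hr.trans_le hrw
    have := isZLattice_hyperplaneSection L hd hv hwv
    have : Fact (finrank ℝ E = n + 1) := ⟨hE⟩
    obtain ⟨⟨c, hcL, hspan, hc⟩, hcov⟩ := ih (finrank_orthogonal_span_singleton hw)
      (hyperplaneSection L w) (r := 3 / 4 * r) (by positivity)
      (three_quarters_le_of_isDualVector_hyperplaneSection hd hv hwv hmin hrw)
    -- Project y orthogonally to the hyperplane, then approximate inside the section. As x pairs to
    -- 0 with `w`, `v - x₀` still pairs to 1.
    have near : ∀ y : E, ∃ x ∈ L, inner ℝ w x = (0 : ℝ) ∧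
        r * ‖y - x‖ ^ 2 ≤ (inner ℝ w y : ℝ) ^ 2 + (4 / 3) ^ n - 1 := by
      intro y
      set s : ℝ := inner ℝ w y with hs
      have hy : y - (s / ‖w‖ ^ 2) • w ∈ (ℝ ∙ w)ᗮ := by
        rw [mem_orthogonal_singleton_iff_inner_right, inner_sub_right, inner_smul_right,
          real_inner_self_eq_norm_sq, ← hs]
        field_simp
        ring
      obtain ⟨x, hx, hxy⟩ := hcov ⟨_, hy⟩
      refine ⟨x, hx, mem_orthogonal_singleton_iff_inner_right.1 x.2, ?_⟩
      have hnorm := norm_sq_smul_add_of_mem_orthogonal (sub_mem hy x.2) (s / ‖w‖ ^ 2)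
      have hxy' : 3 / 4 * r * ‖y - (s / ‖w‖ ^ 2) • w - (x : E)‖ ^ 2 ≤
        3 / 4 * ((4 / 3) ^ n - 1) := hxy
      have heq : (s / ‖w‖ ^ 2) • w + (y - (s / ‖w‖ ^ 2) • w - (x : E)) = y - x := by abel
      rw [heq] at hnorm
      have h1 : r * ((s / ‖w‖ ^ 2) ^ 2 * ‖w‖ ^ 2) ≤ s ^ 2 := by
        have : r * ((s / ‖w‖ ^ 2) ^ 2 * ‖w‖ ^ 2) = s ^ 2 * (r / ‖w‖ ^ 2) := by
          field_simp
        rw [this]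
        exact mul_le_of_le_one_right (sq_nonneg s) ((div_le_one hwp).2 hrw)
      rw [hnorm, mul_add]
      linarith
    obtain ⟨x₀, hx₀, hwx₀, hvx₀⟩ := near v
    have hwv' : inner ℝ w (v - x₀) = (1 : ℝ) := by rw [inner_sub_right, hwv, hwx₀, sub_zero]
    refine ⟨⟨Fin.cons (v - x₀) fun i => (c i : E), ?_, ?_, ?_⟩, ?_⟩
    · refine Fin.cases ?_ fun i => ?_
      · exact L.sub_mem hv hx₀
      · exact hcL i
    · intro x hx
      obtain ⟨z, hz⟩ := hd x hx
      rw [Fin.range_cons]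
      have hx' : x - z • (v - x₀) ∈ (ℝ ∙ w)ᗮ := by
        rw [mem_orthogonal_singleton_iff_inner_right, inner_sub_right,
          ← Int.cast_smul_eq_zsmul ℝ, inner_smul_right, hwv', hz]
        ring
      have hxL : x - z • (v - x₀) ∈ L := L.sub_mem hx (L.smul_mem z (L.sub_mem hv hx₀))
      have hmem := mem_map_of_mem (f := (ℝ ∙ w)ᗮ.subtype.restrictScalars ℤ)
        (hspan (show (⟨_, hx'⟩ : (ℝ ∙ w)ᗮ) ∈ hyperplaneSection L w from hxL))
      rw [map_span, ← Set.range_comp] at hmem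
      rw [← sub_add_cancel x (z • (v - x₀))]
      refine add_mem (span_mono (Set.subset_insert _ _) hmem) (smul_mem _ _ (subset_span ?_))
      exact Set.mem_insert _ _
    · refine Fin.cases ?_ fun i => ?_
      · rw [hwv] at hvx₀
        rw [Fin.cons_zero, pow_succ _ n]
        linarith
      · have h1 : 3 / 4 * r * ‖(c i : E)‖ ^ 2 ≤ 3 / 4 * (4 / 3) ^ n := hc i
        rw [Fin.cons_succ, pow_succ _ n]
        linarith
    · intro y
      set t : ℝ := inner ℝ w y with ht
      -- Moving to the nearest layer leaves a pairing of size at most 1/2 with `w`: 1/4 + (4/3)^n -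
      -- 1 = 3/4 * ((4/3)^(n+1) - 1).
      obtain ⟨x, hx, -, hxy⟩ := near (y - round t • v)
      refine ⟨round t • v + x, L.add_mem (L.smul_mem _ hv) hx, ?_⟩
      rw [inner_sub_right, ← Int.cast_smul_eq_zsmul ℝ, inner_smul_right, hwv, ← ht, mul_one] at hxy
      rw [← Int.cast_smul_eq_zsmul ℝ, ← sub_sub, pow_succ _ n]
      have := abs_le.1 (abs_sub_round t)
      nlinarith

end DualReduction

/-! ### Anisotropic scaling about a unit vector. -/

section AxialScaling

variable {E : Type*} [NormedAddCommGroup E] [InnerProductSpace ℝ E]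

/-- The linear map scaling by `A` along the unit vector `α` and by `B` orthogonally to it. -/
noncomputable def axialScaling (α : E) (A B : ℝ) : E →ₗ[ℝ] E where
  toFun y := (A * inner ℝ α y) • α + B • (y - (inner ℝ α y : ℝ) • α)
  map_add' x y := by
    rw [inner_add_right]
    module
  map_smul' a x := by
    rw [inner_smul_right, RingHom.id_apply]
    module

lemma axialScaling_apply (α : E) (A B : ℝ) (y : E) :
    axialScaling α A B y = (A * inner ℝ α y) • α + B • (y - (inner ℝ α y : ℝ) • α) := rfl

lemma sub_inner_smul_mem_orthogonal {α : E} (hα : ‖α‖ = 1) (y : E) :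
    y - (inner ℝ α y : ℝ) • α ∈ (ℝ ∙ α)ᗮ := by
  rw [mem_orthogonal_singleton_iff_inner_right, inner_sub_right, inner_smul_right,
    real_inner_self_eq_norm_sq, hα]
  ring

lemma norm_sq_axialScaling {α : E} (hα : ‖α‖ = 1) (A B : ℝ) (y : E) :
    ‖axialScaling α A B y‖ ^ 2 =
      A ^ 2 * (inner ℝ α y : ℝ) ^ 2 + B ^ 2 * ‖y - (inner ℝ α y : ℝ) • α‖ ^ 2 := by
  rw [axialScaling_apply, norm_sq_smul_add_of_mem_orthogonal
    (smul_mem _ _ (sub_inner_smul_mem_orthogonal hα y)), hα, norm_smul, mul_pow,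
    mul_pow, Real.norm_eq_abs, sq_abs]
  ring

lemma norm_sq_eq_inner_sq_add {α : E} (hα : ‖α‖ = 1) (y : E) :
    ‖y‖ ^ 2 = (inner ℝ α y : ℝ) ^ 2 + ‖y - (inner ℝ α y : ℝ) • α‖ ^ 2 := by
  have h := norm_sq_smul_add_of_mem_orthogonal (sub_inner_smul_mem_orthogonal hα y)
    (inner ℝ α y : ℝ)
  rw [add_sub_cancel, hα] at h
  linarith

lemma inner_axialScaling_left (α : E) (A B : ℝ) (x y : E) :
    inner ℝ (axialScaling α A B x) y = (inner ℝ x (axialScaling α A B y) : ℝ) := by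
  simp only [axialScaling_apply, inner_add_left, inner_add_right, inner_sub_left, inner_sub_right,
    real_inner_smul_left, inner_smul_right, real_inner_comm x α]
  ring

lemma inner_axialScaling {α : E} (hα : ‖α‖ = 1) (A B : ℝ) (y : E) :
    inner ℝ α (axialScaling α A B y) = (A * inner ℝ α y : ℝ) := by
  rw [axialScaling_apply, inner_add_right, inner_smul_right, inner_smul_right,
    mem_orthogonal_singleton_iff_inner_right.1 (sub_inner_smul_mem_orthogonal hα y),
    real_inner_self_eq_norm_sq, hα]
  ring

lemma axialScaling_injective {α : E} (hα : ‖α‖ = 1) {A B : ℝ} (hA : 0 < A) (hB : 0 < B) :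
    Function.Injective (axialScaling α A B) := by
  rw [injective_iff_map_eq_zero]
  intro y hy
  have h := norm_sq_axialScaling hα A B y
  rw [hy, norm_zero] at h
  have h1 : (inner ℝ α y : ℝ) ^ 2 = 0 := by
    by_contra hne
    have : 0 < (inner ℝ α y : ℝ) ^ 2 := lt_of_le_of_ne (sq_nonneg _) (Ne.symm hne)
    have : 0 < A ^ 2 * (inner ℝ α y : ℝ) ^ 2 := by positivity
    have : 0 ≤ B ^ 2 * ‖y - (inner ℝ α y : ℝ) • α‖ ^ 2 := by positivity
    linarith
  rw [h1] at h
  have h2 : ‖y - (inner ℝ α y : ℝ) • α‖ ^ 2 = 0 := by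
    have := hB.ne'
    simpa [this] using h.symm
  have h3 := norm_sq_eq_inner_sq_add hα y
  rw [h1, h2] at h3
  simpa using h3

end AxialScaling

lemma four_thirds_pow_le_factorial_sq (n : ℕ) :
    ((4 : ℝ) / 3) ^ n ≤ 4 / 3 * (n.factorial : ℝ) ^ 2 := by
  induction n with
  | zero => norm_num
  | succ n ih =>
    rcases Nat.eq_zero_or_pos n with rfl | hn
    · norm_num
    · have hn' : (1 : ℝ) ≤ n := by exact_mod_cast hn
      rw [pow_succ, Nat.factorial_succ]
      push_cast
      rw [mul_pow]
      have : (4 : ℝ) / 3 ≤ ((n : ℝ) + 1) ^ 2 := by nlinarith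
      calc ((4 : ℝ) / 3) ^ n * (4 / 3)
          ≤ (4 / 3 * (n.factorial : ℝ) ^ 2) * ((n : ℝ) + 1) ^ 2 := by gcongr
        _ = _ := by ring

/-! ### Short bases of the scaled integer lattice. -/

namespace TruncDioph

/-- Independence is automatic: a surjective endomorphism of ℤⁿ is injective. -/
lemma isIntBasis_of_top_le_span {n : ℕ} (v : Fin n → Fin n → ℤ)
    (hv : ⊤ ≤ span ℤ (Set.range v)) : IsIntBasis fun j => intVec (v j) := by
  have hsurj : Function.Surjective (Fintype.linearCombination ℤ v) := by
    rw [← LinearMap.range_eq_top, Fintype.range_linearCombination]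
    exact top_le_iff.1 hv
  have hli : LinearIndependent ℤ v := by
    exact linearIndependent_iff_injective_fintypeLinearCombination.2
      (OrzechProperty.injective_of_surjective_endomorphism _ hsurj)
  exact ⟨Basis.mk hli hv, fun j => by rw [Basis.mk_apply]⟩

/-- `intVec` as a `ℤ`-linear map. -/
noncomputable def intVecHom (n : ℕ) : (Fin n → ℤ) →ₗ[ℤ] EuclideanSpace ℝ (Fin n) where
  toFun := intVec
  map_add' x y := by ext i; simp [intVec]
  map_smul' a x := by ext i; simp [intVec]

lemma intVecHom_apply {n : ℕ} (k : Fin n → ℤ) : intVecHom n k = intVec k := rfl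

lemma intVec_injective {n : ℕ} : Function.Injective (intVec (n := n)) := by
  intro k l h
  ext i
  have := congrArg (fun v : EuclideanSpace ℝ (Fin n) => v i) h
  simpa [intVec] using this

lemma one_le_norm_sq_intVec {n : ℕ} {k : Fin n → ℤ} (hk : k ≠ 0) : 1 ≤ ‖intVec k‖ ^ 2 := by
  obtain ⟨i, hi⟩ := Function.ne_iff.1 hk
  rw [EuclideanSpace.real_norm_sq_eq]
  have h1 : (1 : ℝ) ≤ (k i : ℝ) ^ 2 := by
    have : (1 : ℤ) ≤ (k i) ^ 2 := Int.add_one_le_iff.2 (sq_pos_of_ne_zero hi)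
    exact_mod_cast this
  exact h1.trans (Finset.single_le_sum (f := fun i => (intVec k i) ^ 2)
    (fun i _ => sq_nonneg _) (Finset.mem_univ i))

lemma intVec_single {n : ℕ} (i : Fin n) :
    intVec (Pi.single i 1) = EuclideanSpace.basisFun (Fin n) ℝ i := by
  ext j
  simp [intVec, Pi.single_apply, eq_comm]

/-- If the axially scaled integer lattice has no nonzero dual vector shorter than `1`, then `ℤⁿ` has
a basis that is short after scaling and pairs nonnegatively with the axis. -/
theorem exists_intBasis_axialScaling {n : ℕ} {α : EuclideanSpace ℝ (Fin n)} (hα : ‖α‖ = 1)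
    {A B : ℝ} (hA : 0 < A) (hB : 0 < B)
    (hdual : ∀ (w : EuclideanSpace ℝ (Fin n)) (k : Fin n → ℤ), w ≠ 0 →
      axialScaling α A B w = intVec k → 1 ≤ ‖w‖ ^ 2) :
    ∃ v : Fin n → Fin n → ℤ, IsIntBasis (fun j => intVec (v j)) ∧ (∀ j, v j ≠ 0) ∧
      (∀ j, 0 ≤ (inner ℝ α (intVec (v j)) : ℝ)) ∧
      ∀ j, ‖axialScaling α A B (intVec (v j))‖ ^ 2 ≤ 3 / 4 * (4 / 3) ^ n := by
  let E := EuclideanSpace ℝ (Fin n)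
  let T : E →ₗ[ℝ] E := axialScaling α A B
  have hT : Function.Injective T := axialScaling_injective hα hA hB
  let b : Basis (Fin n) ℝ E :=
    (EuclideanSpace.basisFun (Fin n) ℝ).toBasis.map (LinearEquiv.ofInjectiveEndo T hT)
  let φ : (Fin n → ℤ) →ₗ[ℤ] E := T.restrictScalars ℤ ∘ₗ intVecHom n
  have hφ : Function.Injective φ := hT.comp intVec_injective
  have hb : ∀ i, b i = φ (Pi.single i 1) := by
    intro i
    have h1 : φ (Pi.single i 1) = T (intVec (Pi.single i 1)) := rfl
    rw [h1, intVec_single]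
    simp [b]
  have hrange : span ℤ (Set.range b) = LinearMap.range φ := by
    have h1 : (b : Fin n → E) = φ ∘ Pi.basisFun ℤ (Fin n) := by
      ext1 i
      simp [hb]
    rw [h1, Set.range_comp, ← map_span, Basis.span_eq, LinearMap.range_eq_map]
  obtain ⟨⟨c, hcL, hspan, hc⟩, -⟩ := exists_short_generators n (E := E) (by simp [E])
    (span ℤ (Set.range b)) (r := 1) one_pos (by
      intro w hw hd
      have hk : ∀ i, ∃ z : ℤ, inner ℝ (T w) (EuclideanSpace.basisFun (Fin n) ℝ i) = (z : ℝ) := by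
        intro i
        obtain ⟨z, hz⟩ := hd (b i) (subset_span ⟨i, rfl⟩)
        refine ⟨z, ?_⟩
        rw [inner_axialScaling_left, ← hz, hb, ← intVec_single]
        rfl
      choose k hk using hk
      refine hdual w k hw ?_
      ext i
      have := hk i
      rw [EuclideanSpace.basisFun_apply, EuclideanSpace.inner_single_right] at this
      simpa [intVec, T] using this)
  rw [hrange] at hcL hspan
  choose u hu using hcL
  -- Sign changes make the pairings with α nonnegative without affecting norms or the span.
  let s : Fin n → ℤ := fun j => if 0 ≤ (inner ℝ α (intVec (u j)) : ℝ) then 1 else -1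
  have hs : ∀ j, s j * s j = 1 := by
    intro j
    simp only [s]
    split_ifs <;> norm_num
  have hsR : ∀ j, (s j : ℝ) ^ 2 = 1 := by
    intro j
    rw [pow_two]
    exact_mod_cast hs j
  have hsu : ∀ j, intVec (s j • u j) = (s j : ℝ) • intVec (u j) := by
    intro j
    rw [← intVecHom_apply, map_smul, Int.cast_smul_eq_zsmul]
    rfl
  have htop : ⊤ ≤ span ℤ (Set.range fun j => s j • u j) := by
    have h1 : ⊤ ≤ span ℤ (Set.range u) := by
      intro k _
      have hk : φ k ∈ span ℤ (Set.range c) := hspan ⟨k, rfl⟩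
      have h2 : c = φ ∘ u := by
        ext1 j
        exact (hu j).symm
      rw [h2, Set.range_comp, ← map_span] at hk
      obtain ⟨k', hk', h⟩ := hk
      rwa [← hφ h]
    refine h1.trans (span_le.2 ?_)
    rintro _ ⟨j, rfl⟩
    have : u j = s j • s j • u j := by rw [smul_smul, hs, one_smul]
    rw [this]
    exact smul_mem _ _ (subset_span ⟨j, rfl⟩)
  have hbasis := isIntBasis_of_top_le_span _ htop
  refine ⟨fun j => s j • u j, hbasis, ?_, ?_, ?_⟩
  · intro j h
    obtain ⟨b', hb'⟩ := hbasis
    exact b'.ne_zero j (intVec_injective (by rw [hb' j, ← h]))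
  · intro j
    rw [hsu, inner_smul_right]
    simp only [s]
    split_ifs with h
    · simpa using h
    · push_cast
      linarith
  · intro j
    rw [hsu, map_smul, norm_smul, mul_pow, Real.norm_eq_abs, sq_abs, hsR, one_mul]
    have := hc j
    rw [one_mul, ← hu j] at this
    exact this

end TruncDioph

/-! ### Application to the truncated Diophantine vector. -/

theorem proposition1 (n : ℕ) (hn : 2 ≤ n) (τ γ : ℝ) (hτ : (n : ℝ) - 1 < τ)
    (hγ0 : 0 < γ) (hγ1 : γ < 1) (hne : (TruncDioph.unitDiophantine n τ γ).Nonempty)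
    (N : ℝ) (hN : 1 + (n : ℝ) ^ 2 * (n.factorial : ℝ) < N)
    (α : EuclideanSpace ℝ (Fin n)) (hα : α ∈ TruncDioph.unitTruncDiophantine n τ γ N) :
    ∃ (ω : Fin n → EuclideanSpace ℝ (Fin n)) (x : Fin n → ℝ),
      (∀ j, Real.sqrt 3 / 2 < x j ∧ x j ≤ (n : ℝ) * (n.factorial : ℝ) * N ^ τ / γ) ∧
      (∀ j, ‖α - ω j‖ ≤ (n : ℝ) * (n.factorial : ℝ) / (x j * (N - 1))) ∧
      TruncDioph.IsIntBasis (fun j => x j • ω j) := by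
  obtain ⟨hαs, hαd⟩ := hα
  have hα1 : ‖α‖ = 1 := by simpa using hαs
  have hn2 : (2 : ℝ) ≤ n := by exact_mod_cast hn
  have hfac : (1 : ℝ) ≤ n.factorial := by exact_mod_cast n.factorial_pos
  set M : ℝ := (n : ℝ) * (n.factorial : ℝ) with hM
  have hM0 : 0 < M := by positivity
  have hnM : (n : ℝ) ^ 2 * (n.factorial : ℝ) = n * M := by rw [hM]; ring
  have hMN : 2 * M < N - 1 := by
    rw [hnM] at hN
    nlinarith
  have hN1 : 0 < N - 1 := by linarith
  have hN0 : 0 < N := by linarith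
  have hNge : 1 < N := by linarith
  have hτ0 : 0 < τ := by linarith
  have hpow : 0 < N ^ τ := Real.rpow_pos_of_pos hN0 τ
  set A : ℝ := γ * N ^ (-τ) with hA
  have hA0 : 0 < A := mul_pos hγ0 (Real.rpow_pos_of_pos hN0 _)
  have hA1 : A < 1 := by
    have : N ^ (-τ) < 1 := Real.rpow_lt_one_of_one_lt_of_neg hNge (by linarith)
    nlinarith
  have hAinv : M / A = M * N ^ τ / γ := by
    rw [hA, Real.rpow_neg hN0.le]
    field_simp
  obtain ⟨v, hbasis, hv0, hvpos, hvT⟩ :=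
    TruncDioph.exists_intBasis_axialScaling hα1 hA0 hN1 (by
      intro w k hw hwk
      by_contra! hlt
      have hsplit := norm_sq_eq_inner_sq_add hα1 w
      have hnorm := norm_sq_axialScaling hα1 A (N - 1) w
      have hinner := inner_axialScaling hα1 A (N - 1) w
      rw [hwk] at hnorm hinner
      set a : ℝ := inner ℝ α w with ha
      set p : ℝ := ‖w - a • α‖ with hp
      have hkpos : 0 < ‖TruncDioph.intVec k‖ := by
        rw [norm_pos_iff, ← hwk]
        exact fun h => hw (axialScaling_injective hα1 hA0 hN1 (by rw [h, map_zero]))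
      have ha1 : |a| < 1 := by
        rw [← sq_lt_one_iff_abs_lt_one]
        nlinarith [sq_nonneg p]
      -- The factor N-1 rather than N leaves room for the axial part: 1 + (N-1)² ≤ N².
      have hkN : ‖TruncDioph.intVec k‖ ≤ N := by
        refine le_of_sq_le_sq ?_ hN0.le
        rw [hnorm]
        have h1 : A ^ 2 * a ^ 2 ≤ 1 * a ^ 2 := by gcongr; nlinarith
        have h2 : (N - 1) ^ 2 * p ^ 2 ≤ (N - 1) ^ 2 * 1 := by
          gcongr
          nlinarith [sq_nonneg a]
        nlinarith [sq_nonneg p]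
      have hdio := hαd k hkpos hkN
      rw [real_inner_comm, hinner, abs_mul, abs_of_pos hA0] at hdio
      have hmono : N ^ (-τ) ≤ ‖TruncDioph.intVec k‖ ^ (-τ) :=
        Real.rpow_le_rpow_of_nonpos hkpos hkN (by linarith)
      have : A ≤ A * |a| := (mul_le_mul_of_nonneg_left hmono hγ0.le).trans hdio
      nlinarith)
  have hbound : ∀ j, A * inner ℝ α (TruncDioph.intVec (v j)) ≤ M ∧
      (N - 1) * ‖TruncDioph.intVec (v j) - (inner ℝ α (TruncDioph.intVec (v j)) : ℝ) • α‖ ≤ M := by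
    intro j
    have h := (norm_sq_axialScaling hα1 A (N - 1) _).symm.trans_le (hvT j)
    have hf := four_thirds_pow_le_factorial_sq n
    have hle : 3 / 4 * ((4 : ℝ) / 3) ^ n ≤ M ^ 2 := by
      have : (n.factorial : ℝ) ^ 2 ≤ M ^ 2 := by
        gcongr
        exact le_mul_of_one_le_left (by positivity) (by linarith)
      linarith
    rw [← mul_pow, ← mul_pow] at h
    have h' := h.trans hle
    exact ⟨le_of_sq_le_sq ((le_add_of_nonneg_right (sq_nonneg _)).trans h') hM0.le,
      le_of_sq_le_sq ((le_add_of_nonneg_left (sq_nonneg _)).trans h') hM0.le⟩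
  let x : Fin n → ℝ := fun j => inner ℝ α (TruncDioph.intVec (v j))
  have hperp : ∀ j, ‖TruncDioph.intVec (v j) - x j • α‖ ≤ M / (N - 1) := by
    intro j
    rw [le_div_iff₀ hN1, mul_comm]
    exact (hbound j).2
  have hxlow : ∀ j, Real.sqrt 3 / 2 < x j := by
    intro j
    have h1 := norm_sq_eq_inner_sq_add hα1 (TruncDioph.intVec (v j))
    have h2 := TruncDioph.one_le_norm_sq_intVec (hv0 j)
    -- Since N - 1 > 2M, the orthogonal part is below 1/2; as ‖v_j‖ ≥ 1, this leaves x_j² > 3/4.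
    have h3 : ‖TruncDioph.intVec (v j) - x j • α‖ < 1 / 2 :=
      (hperp j).trans_lt (by rw [div_lt_iff₀ hN1]; linarith)
    have h4 : ‖TruncDioph.intVec (v j) - x j • α‖ ^ 2 < (1 / 2) ^ 2 := by gcongr
    have h5 : (Real.sqrt 3 / 2) ^ 2 < x j ^ 2 := by
      rw [div_pow, Real.sq_sqrt (by norm_num)]
      change ‖TruncDioph.intVec (v j)‖ ^ 2 = x j ^ 2 + ‖TruncDioph.intVec (v j) - x j • α‖ ^ 2 at h1
      linarith
    exact lt_of_pow_lt_pow_left₀ 2 (hvpos j) h5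
  have hxpos : ∀ j, 0 < x j := fun j => lt_of_le_of_lt (by positivity) (hxlow j)
  refine ⟨fun j => (x j)⁻¹ • TruncDioph.intVec (v j), x, fun j => ⟨hxlow j, ?_⟩, fun j => ?_, ?_⟩
  · rw [← hAinv, le_div_iff₀ hA0, mul_comm]
    exact (hbound j).1
  · have h1 : α - (x j)⁻¹ • TruncDioph.intVec (v j) =
        -((x j)⁻¹ • (TruncDioph.intVec (v j) - x j • α)) := by
      rw [smul_sub, smul_smul, inv_mul_cancel₀ (hxpos j).ne', one_smul]
      abel
    rw [h1, norm_neg, norm_smul, norm_inv, Real.norm_of_nonneg (hxpos j).le, inv_mul_le_iff₀ (hxpos j)]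
    refine (hperp j).trans (le_of_eq ?_)
    have := (hxpos j).ne'
    field_simp
  · simpa only [smul_inv_smul₀ (hxpos _).ne'] using hbasis
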